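/- Let $A,B,C$ consist of $n_A,n_B,n_C\ge 0$ qubits, $n=n_A+n_B+n_C$, $d=2^n$, $d_A=2^{n_A}$, $d_B=2^{n_B}$. Let $|\Psi\rangle$ be a Haar random pure state of $ABC$ (a uniformly distributed unit vector of $\mathbb{C}^d$) and $\rho_{AB}=\mathrm{Tr}_C|\Psi\rangle\langle\Psi|$. For $0<h\le 1$ the one-shot LU-distillable entanglement $E_{D,h}^{[\mathrm{LU}]}(A:B)$ is the largest $m\in\mathbb{N}$ for which there are unitaries $U_A,U_B$ on $A,B$ and sets $R_A\subseteq A$, $R_B\subseteq B$ of $m$ qubits each, paired with each other, such that $$\mathrm{Tr}\big((U_A\otimes U_B)\,\rho_{AB}\,(U_A\otimes U_B)^\dagger\,\Pi^{[\mathrm{EPR}]}_{R_AR_B}\big)\ge h^2,$$ where $\Pi^{[\mathrm{EPR}]}_{R_AR_B}$ is the projection onto $m$ EPR pairs $\frac{1}{\sqrt2}(|00\rangle+|11\rangle)$ on the paired qubits of $R_A,R_B$, tensored with the identity on the remaining qubits. Let $m\in\mathbb{N}$ and suppose that $\delta:=h^2-2^{-2m}>0$. Then, for every constant $0<c<2$,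 $$\log\Pr\big[E_{D,h}^{[\mathrm{LU}]}(A:B)\ge m\big]\le -c\,\delta^2 d+K\,(d_A^2+d_B^2)\log\frac1\delta$$ ($\log$ is the natural logarithm, $\log 0=-\infty$), with a constant $K>0$ as follows: (a) whenever $n_A<n/2$ and $n_B<n/2$, with $K$ depending only on $c$; (b) for all $n_A,n_B,n_C$, whenever $\delta\le\delta_0$, with $K$ depending only on $c$ and $\delta_0$, for any given $\delta_0<1$. -/

import Mathlib

open MeasureTheory
open scoped Kronecker ENNReal

noncomputable section

/-- Labels of the computational basis of `k` qubits (bit strings of length `k`). -/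
abbrev Qubits (k : ℕ) : Type := Fin k → Fin 2

/-- The Hilbert space of `nA + nB + nC` qubits, split into the subsystems `A`, `B`, `C`. -/
abbrev TripartiteSpace (nA nB nC : ℕ) : Type :=
  EuclideanSpace ℂ (Qubits nA × Qubits nB × Qubits nC)

/-- The set of (normalized) pure states of `ABC`: the unit sphere, of real dimension `2 d - 1`. -/
abbrev PureState (nA nB nC : ℕ) : Type :=
  Metric.sphere (0 : TripartiteSpace nA nB nC) 1

/-- The law of a Haar random pure state of `ABC`: the uniform probability measure on the unit
sphere, i.e. the surface measure of the sphere divided by its total mass. -/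
def haarState (nA nB nC : ℕ) : Measure (PureState nA nB nC) :=
  ((volume : Measure (TripartiteSpace nA nB nC)).toSphere Set.univ)⁻¹ •
    (volume : Measure (TripartiteSpace nA nB nC)).toSphere

/-- The reduced density matrix `ρ_AB = Tr_C |Ψ⟩⟨Ψ|`. -/
def reducedAB {nA nB nC : ℕ} (Ψ : TripartiteSpace nA nB nC) :
    Matrix (Qubits nA × Qubits nB) (Qubits nA × Qubits nB) ℂ :=
  Matrix.of fun x y => ∑ z : Qubits nC, Ψ (x.1, x.2, z) * star (Ψ (y.1, y.2, z))

/-- The action `ρ ↦ (U_A ⊗ U_B) ρ (U_A ⊗ U_B)†` of a local unitary. -/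
def localUnitary {nA nB : ℕ} (UA : Matrix.unitaryGroup (Qubits nA) ℂ)
    (UB : Matrix.unitaryGroup (Qubits nB) ℂ)
    (ρ : Matrix (Qubits nA × Qubits nB) (Qubits nA × Qubits nB) ℂ) :
    Matrix (Qubits nA × Qubits nB) (Qubits nA × Qubits nB) ℂ :=
  ((UA : Matrix (Qubits nA) (Qubits nA) ℂ) ⊗ₖ (UB : Matrix (Qubits nB) (Qubits nB) ℂ)) * ρ *
    ((UA : Matrix (Qubits nA) (Qubits nA) ℂ) ⊗ₖ
      (UB : Matrix (Qubits nB) (Qubits nB) ℂ)).conjTranspose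

/-- The amplitudes of `m` EPR pairs, `((|00⟩ + |11⟩) / √2)^{⊗ m}`, on two registers of `m` qubits:
the `i`-th qubit of the first register is paired with the `i`-th qubit of the second one. -/
def eprState {m : ℕ} (x y : Qubits m) : ℂ :=
  ∏ i : Fin m, if x i = y i then (((Real.sqrt 2)⁻¹ : ℝ) : ℂ) else 0

/-- The projection `|EPR⟩⟨EPR|^{⊗ m}_{R_A R_B} ⊗ 1` onto `m` EPR pairs, where `R_A ⊆ A` and
`R_B ⊆ B` are the sets of `m` qubits enumerated by `rA` and `rB`, and the identity acts on all
the other qubits of `AB`. -/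
def eprProj {nA nB m : ℕ} (rA : Fin m ↪ Fin nA) (rB : Fin m ↪ Fin nB) :
    Matrix (Qubits nA × Qubits nB) (Qubits nA × Qubits nB) ℂ :=
  open Classical in
  Matrix.of fun x y =>
    (eprState (x.1 ∘ rA) (x.2 ∘ rB) * star (eprState (y.1 ∘ rA) (y.2 ∘ rB))) *
      if (∀ i ∉ Set.range rA, x.1 i = y.1 i) ∧ (∀ j ∉ Set.range rB, x.2 j = y.2 j) then 1 else 0

/-- The numbers `m` of EPR pairs which some local unitary distills from `ρ` with fidelity at
least `h ^ 2` (the trace below is a real number whenever `ρ` is a density matrix). -/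
def luDistillableSet {nA nB : ℕ} (h : ℝ)
    (ρ : Matrix (Qubits nA × Qubits nB) (Qubits nA × Qubits nB) ℂ) : Set ℕ :=
  {m | ∃ (rA : Fin m ↪ Fin nA) (rB : Fin m ↪ Fin nB)
      (UA : Matrix.unitaryGroup (Qubits nA) ℂ) (UB : Matrix.unitaryGroup (Qubits nB) ℂ),
      h ^ 2 ≤ (localUnitary UA UB ρ * eprProj rA rB).trace.re}

/-- The set is bounded (by the number of qubits of `A`), so its supremum in `ℕ` is meaningful. -/
theorem bddAbove_luDistillableSet {nA nB : ℕ} (h : ℝ)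
    (ρ : Matrix (Qubits nA × Qubits nB) (Qubits nA × Qubits nB) ℂ) :
    BddAbove (luDistillableSet h ρ) := by
  refine ⟨nA, ?_⟩
  rintro m ⟨rA, -⟩
  simpa using Fintype.card_le_of_embedding rA

/-- The one-shot LU-distillable entanglement of `ρ_AB`, with fidelity parameter `h`. -/
def luDistillable {nA nB : ℕ} (h : ℝ)
    (ρ : Matrix (Qubits nA × Qubits nB) (Qubits nA × Qubits nB) ℂ) : ℕ :=
  sSup (luDistillableSet h ρ)

end

/-! For fixed qubit sets of size k and fixed local unitaries, the fidelity is `‖L†Ψ‖²` for an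
isometry `L` whose range has dimension `p d`, with `p = 4^(-k)`. A linear change of variables on the
sphere (`toSphere_le_norm_adjoint_sq_le`) gives the Chernoff bound `exp(-d · KL(p, x))` for fidelity
at least `x ≥ p`. The fidelity is stable under small changes of the unitaries, and `U(N)` has an
ε-net of size `(75/ε)^(N²)`. A union bound over nets and qubit choices therefore costs about `(d_A²
+ d_B²) log(1/ε)` in the exponent (`haarState_le_luDistillable_le`).

Case (b) takes `ε` proportional to `δ`. Pinsker's inequality `KL ≥ 2(x - p)²` then gives any rate `c
< 2`, and since `log(1/δ)` is bounded below, the constants of the net are absorbed into `K`.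

In case (a), `δ` may be so close to 1 that `log(1/δ)` pays for nothing. There `KL` is about
`log(1/(1 - x))`, and fidelity near 1 degrades only quadratically, so `ε` of order `√(1 - x)`
suffices. The net then costs half a logarithm per dimension and `d_A² + d_B² ≤ d`, so the Chernoff
exponent wins outright. -/

noncomputable section

open scoped Matrix

/-! ### Nets of the unitary group -/

/-- A set whose finite `ε`-separated subsets have at most `N` elements has an `ε`-net with at most
`N` elements. -/
theorem exists_finset_net_of_card_separated_le {X : Type*} [PseudoMetricSpace X] (S : Set X)
    (N : ℕ) {ε : ℝ} (hε : 0 < ε)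
    (h : ∀ s : Finset X, (s : Set X) ⊆ S →
      (∀ x ∈ s, ∀ y ∈ s, x ≠ y → ε ≤ dist x y) → s.card ≤ N) :
    ∃ s : Finset X, (s : Set X) ⊆ S ∧ s.card ≤ N ∧ ∀ x ∈ S, ∃ y ∈ s, dist x y < ε := by
  classical
  let P : ℕ → Prop := fun k => ∃ s : Finset X, (s : Set X) ⊆ S ∧
    (∀ x ∈ s, ∀ y ∈ s, x ≠ y → ε ≤ dist x y) ∧ s.card = k
  have hP0 : P 0 := ⟨∅, by simp, by simp, rfl⟩
  -- A separated subset of maximal cardinality is a net: a point far from all of it could be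
  -- adjoined.
  obtain ⟨s, hsS, hsep, hcard⟩ : P (Nat.findGreatest P N) :=
    Nat.findGreatest_spec (Nat.zero_le N) hP0
  refine ⟨s, hsS, h s hsS hsep, fun x hx => ?_⟩
  by_contra! hfar
  have hxs : x ∉ s := fun hxs => by
    have := hfar x hxs
    rw [dist_self] at this
    linarith
  have hsep' : ∀ a ∈ insert x s, ∀ b ∈ insert x s, a ≠ b → ε ≤ dist a b := by
    intro a ha b hb hab
    rw [Finset.mem_insert] at ha hb
    rcases ha with rfl | ha <;> rcases hb with rfl | hb
    · exact absurd rfl hab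
    · exact hfar b hb
    · rw [dist_comm]; exact hfar a ha
    · exact hsep a ha b hb hab
  have hsub : ((insert x s : Finset X) : Set X) ⊆ S := by
    rw [Finset.coe_insert]
    exact Set.insert_subset hx hsS
  have hle := h _ hsub hsep'
  have := Nat.le_findGreatest (P := P) hle ⟨_, hsub, hsep', rfl⟩
  rw [Finset.card_insert_of_notMem hxs] at this
  omega

/-- Volumetric bound on the number of `t`-separated points in a ball of radius `R`. -/
theorem card_le_of_separated_of_norm_le {E : Type*} [NormedAddCommGroup E] [NormedSpace ℝ E]
    [FiniteDimensional ℝ E] {R t : ℝ} (hR : 0 ≤ R) (ht : 0 < t) (s : Finset E)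
    (hs : ∀ c ∈ s, ‖c‖ ≤ R) (h : ∀ c ∈ s, ∀ d ∈ s, c ≠ d → t ≤ ‖c - d‖) :
    (s.card : ℝ) ≤ (1 + 2 * R / t) ^ Module.finrank ℝ E := by
  borelize E
  let μ : Measure E := Measure.addHaar
  have hδ : 0 < t / 2 := by positivity
  have hρ : 0 < R + t / 2 := by positivity
  have D : Set.Pairwise (s : Set E)
      (Function.onFun Disjoint fun c => Metric.ball (c : E) (t / 2)) := by
    rintro c hc d hd hcd
    apply Metric.ball_disjoint_ball
    rw [dist_eq_norm]
    linarith [h c hc d hd hcd]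
  have hsub : (⋃ c ∈ s, Metric.ball (c : E) (t / 2)) ⊆ Metric.ball (0 : E) (R + t / 2) := by
    refine Set.iUnion₂_subset fun x hx => Metric.ball_subset_ball' ?_
    rw [dist_zero_right]
    linarith [hs x hx]
  have I : (s.card : ℝ≥0∞) * ENNReal.ofReal ((t / 2) ^ Module.finrank ℝ E) *
      μ (Metric.ball 0 1) ≤
      ENNReal.ofReal ((R + t / 2) ^ Module.finrank ℝ E) * μ (Metric.ball 0 1) :=
    calc
      _ = μ (⋃ c ∈ s, Metric.ball (c : E) (t / 2)) := by
        rw [measure_biUnion_finset D fun c _ => measurableSet_ball]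
        simp only [μ.addHaar_ball_of_pos _ hδ, Finset.sum_const, nsmul_eq_mul, mul_assoc]
      _ ≤ μ (Metric.ball (0 : E) (R + t / 2)) := measure_mono hsub
      _ = _ := by simp only [μ.addHaar_ball_of_pos _ hρ]
  have J : (s.card : ℝ≥0∞) * ENNReal.ofReal ((t / 2) ^ Module.finrank ℝ E) ≤
      ENNReal.ofReal ((R + t / 2) ^ Module.finrank ℝ E) :=
    (ENNReal.mul_le_mul_iff_left (Metric.measure_ball_pos _ _ zero_lt_one).ne'
      measure_ball_lt_top.ne).1 I
  have K : (s.card : ℝ) * (t / 2) ^ Module.finrank ℝ E ≤ (R + t / 2) ^ Module.finrank ℝ E := by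
    have := ENNReal.toReal_mono (by simp) J
    simpa [ENNReal.toReal_mul, pow_nonneg hδ.le, pow_nonneg hρ.le] using this
  have hpow : 0 < (t / 2) ^ Module.finrank ℝ E := by positivity
  calc (s.card : ℝ) ≤ (R + t / 2) ^ Module.finrank ℝ E / (t / 2) ^ Module.finrank ℝ E := by
        rwa [le_div_iff₀ hpow]
    _ = (1 + 2 * R / t) ^ Module.finrank ℝ E := by
        rw [← div_pow]
        congr 1
        field_simp
        ring

/-- Two unitaries `V`, `W` at distance at most `1/2` from the identity are controlled by
the skew-adjoint part of their difference. -/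
theorem norm_sub_le_norm_sub_star_of_mem_unitary {A : Type*} [NormedRing A] [NormedSpace ℝ A]
    [StarRing A] [NormedStarGroup A] {V W : A} (hV : V ∈ unitary A) (hW : W ∈ unitary A)
    (hV1 : ‖V - 1‖ ≤ 1 / 2) (hW1 : ‖W - 1‖ ≤ 1 / 2) :
    ‖V - W‖ ≤ ‖(V - star V) - (W - star W)‖ := by
  have hVV : star V * V = 1 := hV.1
  have hWW : star W * W = 1 := hW.1
  -- Since `V*V = W*W`, the self-adjoint part of `V - W` is of second order, and closeness to 1 lets
  -- it be absorbed.
  have key : (V - W) + star (V - W) =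
      -(star (V - 1) * (V - W) + star (V - W) * (W - 1)) := by
    have e : star (V - 1) * (V - W) + star (V - W) * (W - 1) =
        star V * V - star W * W - (V - W) - star (V - W) := by
      simp only [star_sub, star_one]
      noncomm_ring
    rw [e, hVV, hWW]
    abel
  have h1 : ‖(V - W) + star (V - W)‖ ≤ ‖V - W‖ := by
    rw [key, norm_neg]
    calc _ ≤ ‖star (V - 1)‖ * ‖V - W‖ + ‖star (V - W)‖ * ‖W - 1‖ :=
          (norm_add_le _ _).trans (add_le_add (norm_mul_le _ _) (norm_mul_le _ _))
      _ ≤ 1 / 2 * ‖V - W‖ + ‖V - W‖ * (1 / 2) := by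
          rw [norm_star, norm_star]; gcongr
      _ = ‖V - W‖ := by ring
  have h2 : (V - W) + (V - W) =
      ((V - W) + star (V - W)) + ((V - star V) - (W - star W)) := by
    rw [star_sub]; abel
  have h3 : ‖(V - W) + (V - W)‖ = 2 * ‖V - W‖ := by
    rw [← two_smul ℝ (V - W), norm_smul, Real.norm_two]
  have h4 := norm_add_le ((V - W) + star (V - W)) ((V - star V) - (W - star W))
  rw [← h2, h3] at h4
  linarith

/-- Re + Im of the entries (i,j) and (j,i) determines both, since skewness flips the sign of Re and
keeps Im. The exponent `N²` instead of `2N²` is decisive for δ near 1. -/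
theorem finrank_skewAdjoint_matrix_le (n : Type*) [Fintype n] [DecidableEq n] :
    Module.finrank ℝ (skewAdjoint.submodule ℝ (Matrix n n ℂ)) ≤ Fintype.card n ^ 2 := by
  let f : skewAdjoint.submodule ℝ (Matrix n n ℂ) →ₗ[ℝ] (n × n → ℝ) :=
    { toFun := fun S p => (S.1 p.1 p.2).re + (S.1 p.1 p.2).im
      map_add' := fun S T => by ext p; simp; ring
      map_smul' := fun r S => by ext p; simp; ring }
  have hf : Function.Injective f := by
    rw [← LinearMap.ker_eq_bot, LinearMap.ker_eq_bot']
    intro S hS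
    have hskew : star S.1 = -S.1 := S.2
    have e : ∀ i j, S.1 i j = 0 := by
      intro i j
      have h1 : (S.1 i j).re + (S.1 i j).im = 0 := congrFun hS (i, j)
      have h2 : (S.1 j i).re + (S.1 j i).im = 0 := congrFun hS (j, i)
      have h3 : star (S.1 j i) = -S.1 i j := congrFun (congrFun hskew i) j
      have h4 := congrArg Complex.re h3
      have h5 := congrArg Complex.im h3
      simp at h4 h5
      apply Complex.ext <;> simp <;> linarith
    ext i j
    simpa using e i j
  have := LinearMap.finrank_le_finrank_of_injective hf
  simpa [Fintype.card_prod, sq] using this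

theorem norm_le_one_of_mem_unitary {A : Type*} [NormedRing A] [StarRing A] [CStarRing A] {U : A}
    (hU : U ∈ unitary A) : ‖U‖ ≤ 1 := by
  rcases subsingleton_or_nontrivial A with h | h
  · rw [Subsingleton.elim U 0, norm_zero]
    exact zero_le_one
  · exact (CStarRing.norm_of_mem_unitary hU).le

open scoped Matrix.Norms.L2Operator in
/-- The unitary group has an `ε`-net whose size is governed by its real dimension
`(card n) ^ 2`. -/
theorem exists_unitary_net (n : Type*) [Fintype n] [DecidableEq n] {ε : ℝ} (hε : 0 < ε)
    (hε1 : ε ≤ 1) :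
    ∃ s : Finset (Matrix.unitaryGroup n ℂ), (s.card : ℝ) ≤ (75 / ε) ^ (Fintype.card n ^ 2) ∧
      ∀ U : Matrix.unitaryGroup n ℂ, ∃ V ∈ s, ‖(U : Matrix n n ℂ) - V‖ < ε := by
  classical
  have hnorm : ∀ U : Matrix.unitaryGroup n ℂ, ‖(U : Matrix n n ℂ)‖ ≤ 1 := fun U =>
    norm_le_one_of_mem_unitary U.2
  -- Two scales. In the full matrix space, of real dimension `2N²`, a volume count at scale 1/2
  -- gives `5^(2N²) = 25^(N²)`; this factor does not involve ε.
  have hcoarse : ∀ s : Finset (Matrix.unitaryGroup n ℂ),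
      (s : Set (Matrix.unitaryGroup n ℂ)) ⊆ Set.univ →
      (∀ x ∈ s, ∀ y ∈ s, x ≠ y → 1 / 2 ≤ dist x y) →
        s.card ≤ ⌊(25 : ℝ) ^ (Fintype.card n ^ 2)⌋₊ := by
    intro s _ hsep
    have hb := card_le_of_separated_of_norm_le (E := Matrix n n ℂ) (R := 1) (t := 1 / 2)
      zero_le_one (by norm_num) (s.map ⟨Subtype.val, Subtype.val_injective⟩)
      (fun c hc => by
        obtain ⟨U, -, rfl⟩ := Finset.mem_map.1 hc
        exact hnorm U)
      (fun c hc d hd hcd => by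
        obtain ⟨U, hU, rfl⟩ := Finset.mem_map.1 hc
        obtain ⟨V, hV, rfl⟩ := Finset.mem_map.1 hd
        rw [← dist_eq_norm]
        exact hsep U hU V hV (fun e => hcd (by rw [e])))
    rw [Finset.card_map] at hb
    refine Nat.le_floor (hb.trans_eq ?_)
    have hfin : Module.finrank ℝ (Matrix n n ℂ) = 2 * Fintype.card n ^ 2 := by
      rw [Module.finrank_matrix, Complex.finrank_real_complex]; ring
    rw [hfin, pow_mul]
    norm_num
  have hfine : ∀ U₀ : Matrix.unitaryGroup n ℂ, ∀ s : Finset (Matrix.unitaryGroup n ℂ),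
      (s : Set (Matrix.unitaryGroup n ℂ)) ⊆ {U | dist U U₀ ≤ 1 / 2} →
      (∀ x ∈ s, ∀ y ∈ s, x ≠ y → ε ≤ dist x y) →
        s.card ≤ ⌊(3 / ε : ℝ) ^ (Fintype.card n ^ 2)⌋₊ := by
    intro U₀ s hs hsep
    -- Translated to the identity, a ball of radius 1/2 is charted by skew-adjoint parts. The chart
    -- does not decrease distances, so the volume count takes place in dimension at most `N²`.
    let g : Matrix.unitaryGroup n ℂ → skewAdjoint.submodule ℝ (Matrix n n ℂ) := fun U =>
      ⟨((U₀⁻¹ * U : Matrix.unitaryGroup n ℂ) : Matrix n n ℂ) -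
        star ((U₀⁻¹ * U : Matrix.unitaryGroup n ℂ) : Matrix n n ℂ), by
        change star _ = -_
        rw [star_sub, star_star, neg_sub]⟩
    have hleft : ∀ U V : Matrix.unitaryGroup n ℂ,
        ‖((U₀⁻¹ * U : Matrix.unitaryGroup n ℂ) : Matrix n n ℂ) -
          ((U₀⁻¹ * V : Matrix.unitaryGroup n ℂ) : Matrix n n ℂ)‖ = dist U V := by
      intro U V
      rw [Submonoid.coe_mul, Submonoid.coe_mul, ← mul_sub]
      exact (CStarRing.norm_coe_unitary_mul (U₀⁻¹) _).trans (dist_eq_norm _ _).symm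
    have hone : ∀ U ∈ s, ‖((U₀⁻¹ * U : Matrix.unitaryGroup n ℂ) : Matrix n n ℂ) - 1‖ ≤ 1 / 2 := by
      intro U hU
      have := hleft U U₀
      rw [inv_mul_cancel] at this
      exact this.trans_le (hs hU)
    have hsepg : ∀ U ∈ s, ∀ V ∈ s, dist U V ≤ ‖g U - g V‖ := by
      intro U hU V hV
      rw [← hleft]
      exact norm_sub_le_norm_sub_star_of_mem_unitary (U₀⁻¹ * U).2 (U₀⁻¹ * V).2 (hone U hU)
        (hone V hV)
    have hinj : Set.InjOn g s := by
      intro U hU V hV hUV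
      by_contra hne
      have h1 := hsep U hU V hV hne
      have h2 := hsepg U hU V hV
      rw [hUV, sub_self, norm_zero] at h2
      linarith
    have hb := card_le_of_separated_of_norm_le (E := skewAdjoint.submodule ℝ (Matrix n n ℂ))
      (R := 1) (t := ε) zero_le_one hε (s.image g)
      (fun c hc => by
        obtain ⟨U, hU, rfl⟩ := Finset.mem_image.1 hc
        have e : ((g U : skewAdjoint.submodule ℝ (Matrix n n ℂ)) : Matrix n n ℂ) =
            (((U₀⁻¹ * U : Matrix.unitaryGroup n ℂ) : Matrix n n ℂ) - 1) -
            star (((U₀⁻¹ * U : Matrix.unitaryGroup n ℂ) : Matrix n n ℂ) - 1) := by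
          rw [star_sub, star_one, sub_sub_sub_cancel_right]
        refine (congrArg norm e).trans_le ((norm_sub_le _ _).trans ?_)
        rw [norm_star]
        linarith [hone U hU])
      (fun c hc d hd hcd => by
        obtain ⟨U, hU, rfl⟩ := Finset.mem_image.1 hc
        obtain ⟨V, hV, rfl⟩ := Finset.mem_image.1 hd
        exact (hsep U hU V hV (fun e => hcd (by rw [e]))).trans (hsepg U hU V hV))
    rw [Finset.card_image_of_injOn hinj] at hb
    refine Nat.le_floor (hb.trans ?_)
    have h3 : 1 + 2 * 1 / ε ≤ 3 / ε := by
      rw [le_div_iff₀ hε, add_mul, div_mul_cancel₀ _ hε.ne']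
      linarith
    have h1 : 1 ≤ 1 + 2 * 1 / ε := by
      have : 0 < 2 * 1 / ε := by positivity
      linarith
    exact (pow_le_pow_right₀ h1 (finrank_skewAdjoint_matrix_le n)).trans
      (pow_le_pow_left₀ (zero_le_one.trans h1) h3 _)
  obtain ⟨s, -, hscard, hs⟩ := exists_finset_net_of_card_separated_le _ _ (by norm_num) hcoarse
  choose t ht htcard htnet using fun U₀ =>
    exists_finset_net_of_card_separated_le _ _ hε (hfine U₀)
  refine ⟨s.biUnion t, ?_, fun U => ?_⟩
  · calc ((s.biUnion t).card : ℝ) ≤ ((∑ U ∈ s, (t U).card : ℕ) : ℝ) := by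
          exact_mod_cast Finset.card_biUnion_le
      _ ≤ ((s.card * ⌊(3 / ε : ℝ) ^ (Fintype.card n ^ 2)⌋₊ : ℕ) : ℝ) := by
          exact_mod_cast (Finset.sum_le_card_nsmul _ _ _ fun U _ => htcard U).trans_eq
            (smul_eq_mul _ _)
      _ ≤ (25 : ℝ) ^ (Fintype.card n ^ 2) * (3 / ε) ^ (Fintype.card n ^ 2) := by
          rw [Nat.cast_mul]
          gcongr
          · exact (Nat.cast_le.2 hscard).trans (Nat.floor_le (by positivity))
          · exact Nat.floor_le (by positivity)
      _ = (75 / ε) ^ (Fintype.card n ^ 2) := by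
          rw [← mul_pow]
          congr 1
          ring
  · obtain ⟨U₀, hU₀, hdist⟩ := hs U trivial
    obtain ⟨V, hV, hVd⟩ := htnet U₀ U hdist.le
    exact ⟨V, Finset.mem_biUnion.2 ⟨U₀, hU₀, hV⟩, by rwa [← dist_eq_norm]⟩

/-! ### Projections of a random unit vector -/

/-- The spherical measure of the directions which a linear map does not expand is controlled by
its determinant. -/
theorem toSphere_setOf_norm_map_le_one_le {E : Type*} [NormedAddCommGroup E] [NormedSpace ℝ E]
    [FiniteDimensional ℝ E] [MeasurableSpace E] [BorelSpace E] (μ : Measure E)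
    [μ.IsAddHaarMeasure] (T : E →ₗ[ℝ] E) (hT : LinearMap.det T ≠ 0) :
    μ.toSphere {u | ‖T u‖ ≤ 1} ≤
      ENNReal.ofReal |(LinearMap.det T)⁻¹| * μ.toSphere Set.univ := by
  have hcont : Continuous T := T.continuous_of_finiteDimensional
  have hmeas : MeasurableSet {u : Metric.sphere (0 : E) 1 | ‖T u‖ ≤ 1} :=
    (isClosed_le (hcont.comp continuous_subtype_val).norm continuous_const).measurableSet
  rw [μ.toSphere_apply' hmeas, μ.toSphere_apply_univ, mul_left_comm,
    ← μ.addHaar_preimage_linearMap hT]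
  gcongr
  -- The spherical measure is a multiple of the volume of the cone over the set, and `T` maps this
  -- cone into the unit ball.
  rintro _ ⟨r, hr, _, ⟨u, hu, rfl⟩, rfl⟩
  have hu' : ‖T u‖ ≤ 1 := hu
  simp only [Set.mem_preimage, Metric.mem_ball, dist_zero_right, map_smul, norm_smul,
    Real.norm_of_nonneg hr.1.le]
  nlinarith [hr.1, hr.2, norm_nonneg (T u)]

section Isometry

variable {E F : Type*} [NormedAddCommGroup E] [InnerProductSpace ℂ E] [FiniteDimensional ℂ E]
  [NormedAddCommGroup F] [InnerProductSpace ℂ F] [FiniteDimensional ℂ F]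

theorem norm_apply_of_adjoint_comp_eq_id {L : F →ₗ[ℂ] E} (hL : L.adjoint ∘ₗ L = LinearMap.id)
    (w : F) : ‖L w‖ = ‖w‖ := by
  have h : inner ℂ (L w) (L w) = inner ℂ w w := by
    rw [← LinearMap.adjoint_inner_left, ← LinearMap.comp_apply, hL, LinearMap.id_apply]
  rw [inner_self_eq_norm_sq_to_K, inner_self_eq_norm_sq_to_K] at h
  exact (sq_eq_sq₀ (norm_nonneg _) (norm_nonneg _)).1 (by exact_mod_cast h)

theorem norm_add_smul_comp_adjoint_sq {L : F →ₗ[ℂ] E} (hL : L.adjoint ∘ₗ L = LinearMap.id)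
    (t : ℝ) (v : E) :
    ‖v + (t : ℂ) • L (L.adjoint v)‖ ^ 2 =
      ‖v‖ ^ 2 + (2 * t + t ^ 2) * ‖L.adjoint v‖ ^ 2 := by
  have h : inner ℂ v (L (L.adjoint v)) = ((‖L.adjoint v‖ ^ 2 : ℝ) : ℂ) := by
    rw [← LinearMap.adjoint_inner_left, inner_self_eq_norm_sq_to_K]
    norm_cast
  rw [@norm_add_sq ℂ, inner_smul_right, h, norm_smul, norm_apply_of_adjoint_comp_eq_id hL,
    Complex.norm_real, mul_pow, Real.norm_eq_abs, sq_abs, ← Complex.ofReal_mul]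
  simp only [RCLike.re_to_complex, Complex.ofReal_re]
  ring

theorem norm_sub_comp_adjoint_sq {L : F →ₗ[ℂ] E} (hL : L.adjoint ∘ₗ L = LinearMap.id) (v : E) :
    ‖v - L (L.adjoint v)‖ ^ 2 = ‖v‖ ^ 2 - ‖L.adjoint v‖ ^ 2 := by
  have h := norm_add_smul_comp_adjoint_sq hL (-1) v
  rw [Complex.ofReal_neg, Complex.ofReal_one, neg_one_smul, ← sub_eq_add_neg] at h
  rw [h]
  ring

theorem norm_adjoint_le {L : F →ₗ[ℂ] E} (hL : L.adjoint ∘ₗ L = LinearMap.id) (v : E) :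
    ‖L.adjoint v‖ ≤ ‖v‖ := by
  have h := norm_sub_comp_adjoint_sq hL v
  exact (sq_le_sq₀ (norm_nonneg _) (norm_nonneg _)).1 (by linarith [sq_nonneg ‖v - L (L.adjoint v)‖])

theorem norm_sub_comp_adjoint_le {L : F →ₗ[ℂ] E} (hL : L.adjoint ∘ₗ L = LinearMap.id) (v : E) :
    ‖v - L (L.adjoint v)‖ ≤ ‖v‖ := by
  have h := norm_sub_comp_adjoint_sq hL v
  exact (sq_le_sq₀ (norm_nonneg _) (norm_nonneg _)).1 (by linarith [sq_nonneg ‖L.adjoint v‖])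

/-- `‖L†·‖` is 1-Lipschitz and `(h - t)² ≥ h² - 2t` as `h ≤ 1`; for `t ≥ h` the left side is not
positive. -/
theorem sub_le_norm_adjoint_sq {L : F →ₗ[ℂ] E} (hL : L.adjoint ∘ₗ L = LinearMap.id) {v w : E}
    {h t : ℝ} (h0 : 0 ≤ h) (h1 : h ≤ 1) (hvw : ‖v - w‖ ≤ t) (hv : h ^ 2 ≤ ‖L.adjoint v‖ ^ 2) :
    h ^ 2 - 2 * t ≤ ‖L.adjoint w‖ ^ 2 := by
  have ht : 0 ≤ t := (norm_nonneg _).trans hvw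
  have hv' : h ≤ ‖L.adjoint v‖ := (sq_le_sq₀ h0 (norm_nonneg _)).1 hv
  have hd : ‖L.adjoint v‖ - ‖L.adjoint w‖ ≤ t := by
    refine (norm_sub_norm_le _ _).trans ?_
    rw [← map_sub]
    exact (norm_adjoint_le hL _).trans hvw
  have hw : h - t ≤ ‖L.adjoint w‖ := by linarith
  rcases le_total t h with hth | hth
  · nlinarith [pow_le_pow_left₀ (sub_nonneg.2 hth) hw 2]
  · nlinarith [sq_nonneg ‖L.adjoint w‖]

/-- The root of the infidelity is the distance to the range of `L`, which is 1-Lipschitz. Near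
fidelity 1 the loss is thus quadratic. -/
theorem one_sub_sq_le_norm_adjoint_sq {L : F →ₗ[ℂ] E} (hL : L.adjoint ∘ₗ L = LinearMap.id)
    {v w : E} {s t : ℝ} (hs : 0 ≤ s) (hv1 : ‖v‖ = 1) (hw1 : ‖w‖ = 1) (hvw : ‖v - w‖ ≤ t)
    (hv : 1 - s ^ 2 ≤ ‖L.adjoint v‖ ^ 2) :
    1 - (s + t) ^ 2 ≤ ‖L.adjoint w‖ ^ 2 := by
  have hv' : ‖v - L (L.adjoint v)‖ ≤ s := by
    refine (sq_le_sq₀ (norm_nonneg _) hs).1 ?_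
    rw [norm_sub_comp_adjoint_sq hL, hv1]
    linarith
  have hd : ‖w - L (L.adjoint w)‖ ≤ s + t := by
    have e : w - L (L.adjoint w) =
        (v - L (L.adjoint v)) - ((v - w) - L (L.adjoint (v - w))) := by
      simp only [map_sub]; abel
    rw [e]
    exact (norm_sub_le _ _).trans
      (add_le_add hv' ((norm_sub_comp_adjoint_le hL _).trans hvw))
  have := pow_le_pow_left₀ (norm_nonneg _) hd 2
  rw [norm_sub_comp_adjoint_sq hL, hw1] at this
  linarith

end Isometry


theorem adjoint_comp_toEuclideanLin_eq_id {ι κ : Type*} [Fintype ι] [DecidableEq ι] [Fintype κ]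
    [DecidableEq κ] {J : Matrix ι κ ℂ} (hJ : Jᴴ * J = 1) :
    (Matrix.toEuclideanLin J).adjoint ∘ₗ Matrix.toEuclideanLin J = LinearMap.id := by
  rw [← Matrix.toEuclideanLin_conjTranspose_eq_adjoint]
  refine LinearMap.ext fun v => ?_
  simp only [LinearMap.comp_apply, Matrix.toLpLin_apply, Matrix.mulVec_mulVec, hJ,
    Matrix.one_mulVec, LinearMap.id_apply]

/-- Chernoff bound for the squared length of the projection of a random unit vector onto the range
of an isometry. -/
theorem toSphere_le_norm_adjoint_sq_le {ι κ : Type*} [Fintype ι] [DecidableEq ι] [Fintype κ]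
    [DecidableEq κ] {J : Matrix ι κ ℂ} (hJ : Jᴴ * J = 1) {a b x : ℝ} (ha : 0 < a)
    (hab : a ≤ b) (hx : x * a + (1 - x) * b = 1) :
    (volume : Measure (EuclideanSpace ℂ ι)).toSphere
      {v | x ≤ ‖(Matrix.toEuclideanLin J).adjoint v.1‖ ^ 2} ≤
      ENNReal.ofReal (b ^ Fintype.card ι * (a / b) ^ Fintype.card κ)⁻¹ *
        (volume : Measure (EuclideanSpace ℂ ι)).toSphere Set.univ := by
  have hb : 0 < b := ha.trans_le hab
  have hL := adjoint_comp_toEuclideanLin_eq_id hJ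
  set L := Matrix.toEuclideanLin J with hLdef
  set t : ℝ := √(a / b) - 1 with ht
  -- `A` scales the range of `J` by `√a` and its complement by `√b`. The constraint on `x` makes
  -- `‖Av‖ ≤ 1` whenever the projection has squared length at least `x`.
  let A : Matrix ι ι ℂ := ((√b : ℝ) : ℂ) • (1 + ((t : ℂ) • J) * Jᴴ)
  let T : EuclideanSpace ℂ ι →ₗ[ℝ] EuclideanSpace ℂ ι := (Matrix.toEuclideanLin A).restrictScalars ℝ
  have hTapp : ∀ v, T v = ((√b : ℝ) : ℂ) • (v + (t : ℂ) • L (L.adjoint v)) := by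
    intro v
    change Matrix.toEuclideanLin A v = _
    rw [hLdef, ← Matrix.toEuclideanLin_conjTranspose_eq_adjoint]
    ext i
    simp [A, Matrix.toLpLin_apply, Matrix.smul_mulVec,
      Matrix.mulVec_mulVec]
  have htb : 2 * t + t ^ 2 = a / b - 1 := by
    have := Real.sq_sqrt (div_pos ha hb).le
    rw [ht]; linear_combination this
  have hTnorm : ∀ v, ‖T v‖ ^ 2 = b * ‖v‖ ^ 2 - (b - a) * ‖L.adjoint v‖ ^ 2 := by
    intro v
    rw [hTapp, norm_smul, mul_pow, norm_add_smul_comp_adjoint_sq hL, htb, Complex.norm_real,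
      Real.norm_eq_abs, sq_abs, Real.sq_sqrt hb.le]
    field_simp
    ring
  have hdetA : A.det = ((√b ^ Fintype.card ι * √(a / b) ^ Fintype.card κ : ℝ) : ℂ) := by
    simp only [A]
    rw [Matrix.det_smul, Matrix.det_one_add_mul_comm, Matrix.mul_smul, hJ]
    have : (1 + (t : ℂ) • (1 : Matrix κ κ ℂ)) = ((√(a / b) : ℝ) : ℂ) • (1 : Matrix κ κ ℂ) := by
      rw [ht, Complex.ofReal_sub, sub_smul, Complex.ofReal_one, one_smul]
      abel
    rw [this, Matrix.det_smul, Matrix.det_one]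
    push_cast
    ring
  -- The real determinant is the squared modulus of the complex one, which removes the square roots.
  have hdet : LinearMap.det T = b ^ Fintype.card ι * (a / b) ^ Fintype.card κ := by
    rw [LinearMap.det_restrictScalars, Matrix.toEuclideanLin_eq_toLin_orthonormal,
      LinearMap.det_toLin, hdetA, Algebra.norm_complex_apply, Complex.normSq_ofReal]
    calc _ = (√b ^ 2) ^ Fintype.card ι * (√(a / b) ^ 2) ^ Fintype.card κ := by ring
      _ = _ := by rw [Real.sq_sqrt hb.le, Real.sq_sqrt (div_pos ha hb).le]
  have hpos : 0 < b ^ Fintype.card ι * (a / b) ^ Fintype.card κ := by positivity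
  have key := toSphere_setOf_norm_map_le_one_le (volume : Measure (EuclideanSpace ℂ ι)) T
    (hdet ▸ hpos.ne')
  rw [hdet, abs_of_pos (inv_pos.2 hpos)] at key
  refine (measure_mono fun v hv => ?_).trans key
  have hv' : x ≤ ‖L.adjoint v.1‖ ^ 2 := hv
  have hv1 : ‖v.1‖ = 1 := mem_sphere_zero_iff_norm.1 v.2
  refine (sq_le_sq₀ (norm_nonneg _) zero_le_one).1 ?_
  rw [hTnorm, hv1]
  nlinarith [mul_le_mul_of_nonneg_left hv' (sub_nonneg.2 hab)]

/-! ### The EPR projection as a range projection -/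

theorem eprState_eq {m : ℕ} (x y : Qubits m) :
    eprState x y = if x = y then (((Real.sqrt 2)⁻¹ : ℝ) : ℂ) ^ m else 0 := by
  unfold eprState
  split_ifs with h
  · subst h; simp
  · obtain ⟨i, hi⟩ := Function.ne_iff.1 h
    exact Finset.prod_eq_zero (Finset.mem_univ i) (if_neg hi)

theorem sum_star_eprState_mul_eprState (m : ℕ) :
    ∑ x : Qubits m, ∑ y : Qubits m, star (eprState x y) * eprState x y = 1 := by
  have h2 : ((√2 : ℝ) : ℂ) ^ 2 = 2 := by
    rw [← Complex.ofReal_pow, Real.sq_sqrt zero_le_two]; norm_num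
  simp only [eprState_eq, mul_ite, mul_zero, Finset.sum_ite_eq, Finset.mem_univ, if_true,
    Finset.sum_const, Finset.card_univ, Fintype.card_pi, Fintype.card_fin, Finset.prod_const,
    nsmul_eq_mul]
  rw [star_pow, ← mul_pow, ← starRingEnd_apply, Complex.conj_ofReal, Nat.cast_pow, ← mul_pow]
  rw [Complex.ofReal_inv, ← sq, inv_pow, h2]
  norm_num

/-- Splitting of a bit string into the selected bits and the remaining ones. -/
def qubitSplit {n m : ℕ} (r : Fin m ↪ Fin n) :
    Qubits n ≃ Qubits m × (((Set.range r)ᶜ : Set (Fin n)) → Fin 2) :=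
  open Classical in
  (Equiv.arrowCongr (((Equiv.ofInjective r r.injective).sumCongr (Equiv.refl _)).trans
    (Equiv.Set.sumCompl (Set.range r))).symm (Equiv.refl (Fin 2))).trans
    (Equiv.sumArrowEquivProdArrow _ _ _)

theorem qubitSplit_fst {n m : ℕ} (r : Fin m ↪ Fin n) (x : Qubits n) :
    (qubitSplit r x).1 = x ∘ r := by
  ext i; simp [qubitSplit]

theorem qubitSplit_snd {n m : ℕ} (r : Fin m ↪ Fin n) (x : Qubits n) :
    (qubitSplit r x).2 = fun i : ((Set.range r)ᶜ : Set (Fin n)) => x i := by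
  ext i; simp [qubitSplit]

/-- The isometry which adjoins `m` EPR pairs to a state of the remaining qubits. -/
def eprIsometry {nA nB m : ℕ} (rA : Fin m ↪ Fin nA) (rB : Fin m ↪ Fin nB) :
    Matrix (Qubits nA × Qubits nB)
      ((((Set.range rA)ᶜ : Set (Fin nA)) → Fin 2) × (((Set.range rB)ᶜ : Set (Fin nB)) → Fin 2)) ℂ :=
  open Classical in
  Matrix.of fun x k => eprState (qubitSplit rA x.1).1 (qubitSplit rB x.2).1 *
    ((if (qubitSplit rA x.1).2 = k.1 then 1 else 0) * if (qubitSplit rB x.2).2 = k.2 then 1 else 0)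

theorem eprIsometry_conjTranspose_mul_self {nA nB m : ℕ} (rA : Fin m ↪ Fin nA)
    (rB : Fin m ↪ Fin nB) [DecidableEq ((((Set.range rA)ᶜ : Set (Fin nA)) → Fin 2) ×
      (((Set.range rB)ᶜ : Set (Fin nB)) → Fin 2))]
    [Fintype (((Set.range rA)ᶜ : Set (Fin nA)) → Fin 2)]
    [Fintype (((Set.range rB)ᶜ : Set (Fin nB)) → Fin 2)] :
    (eprIsometry rA rB)ᴴ * eprIsometry rA rB = 1 := by
  classical
  ext ⟨k₁, k₂⟩ ⟨l₁, l₂⟩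
  rw [Matrix.mul_apply, ← Equiv.sum_comp ((qubitSplit rA).prodCongr (qubitSplit rB)).symm]
  simp only [eprIsometry, Matrix.conjTranspose_apply, Matrix.of_apply, Equiv.prodCongr_symm,
    Equiv.prodCongr_apply, Prod.map, Equiv.apply_symm_apply]
  have e : ∀ x : (Qubits m × (((Set.range rA)ᶜ : Set (Fin nA)) → Fin 2)) ×
      (Qubits m × (((Set.range rB)ᶜ : Set (Fin nB)) → Fin 2)),
      star (eprState x.1.1 x.2.1 * ((if x.1.2 = k₁ then 1 else 0) * if x.2.2 = k₂ then 1 else 0)) *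
        (eprState x.1.1 x.2.1 * ((if x.1.2 = l₁ then 1 else 0) * if x.2.2 = l₂ then 1 else 0)) =
      (star (eprState x.1.1 x.2.1) * eprState x.1.1 x.2.1) *
        (((if x.1.2 = k₁ then 1 else 0) * (if x.2.2 = k₂ then 1 else 0)) *
        ((if k₁ = l₁ then 1 else 0) * if k₂ = l₂ then 1 else 0)) := by
    intro x
    by_cases h1 : x.1.2 = k₁ <;> by_cases h2 : x.2.2 = k₂ <;>
      simp [h1, h2]
  rw [Finset.sum_congr rfl fun x _ => e x]
  simp only [← mul_assoc]
  rw [← Finset.sum_mul, ← Finset.sum_mul]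
  have h1 : ∑ x : (Qubits m × (((Set.range rA)ᶜ : Set (Fin nA)) → Fin 2)) ×
      (Qubits m × (((Set.range rB)ᶜ : Set (Fin nB)) → Fin 2)),
      star (eprState x.1.1 x.2.1) * eprState x.1.1 x.2.1 * (if x.1.2 = k₁ then 1 else 0) *
        (if x.2.2 = k₂ then 1 else 0) = 1 := by
    simp only [Fintype.sum_prod_type, mul_ite, mul_one, mul_zero, Finset.sum_ite_eq',
      Finset.mem_univ, if_true]
    rw [← sum_star_eprState_mul_eprState m]
    refine Finset.sum_congr rfl fun u _ => ?_
    rw [Finset.sum_comm]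
    simp
  rw [h1, one_mul]
  simp only [Matrix.one_apply, Prod.mk.injEq]
  by_cases h1 : k₁ = l₁ <;> by_cases h2 : k₂ = l₂ <;> simp [h1, h2]

theorem eprProj_eq_mul_conjTranspose {nA nB m : ℕ} (rA : Fin m ↪ Fin nA) (rB : Fin m ↪ Fin nB)
    [Fintype (((Set.range rA)ᶜ : Set (Fin nA)) → Fin 2)]
    [Fintype (((Set.range rB)ᶜ : Set (Fin nB)) → Fin 2)] :
    eprProj rA rB = eprIsometry rA rB * (eprIsometry rA rB)ᴴ := by
  classical
  ext x y
  have hA : (∀ i ∉ Set.range rA, x.1 i = y.1 i) ↔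
      (qubitSplit rA y.1).2 = (qubitSplit rA x.1).2 := by
    rw [qubitSplit_snd, qubitSplit_snd, funext_iff, Subtype.forall]
    exact forall₂_congr fun i _ => eq_comm
  have hB : (∀ j ∉ Set.range rB, x.2 j = y.2 j) ↔
      (qubitSplit rB y.2).2 = (qubitSplit rB x.2).2 := by
    rw [qubitSplit_snd, qubitSplit_snd, funext_iff, Subtype.forall]
    exact forall₂_congr fun i _ => eq_comm
  simp only [eprProj, Matrix.of_apply, hA, hB]
  rw [Matrix.mul_apply, Fintype.sum_prod_type]
  simp only [eprIsometry, Matrix.conjTranspose_apply, Matrix.of_apply, ← qubitSplit_fst]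
  rw [Finset.sum_eq_single (qubitSplit rA x.1).2, Finset.sum_eq_single (qubitSplit rB x.2).2]
  · by_cases h1 : (qubitSplit rA y.1).2 = (qubitSplit rA x.1).2 <;>
      by_cases h2 : (qubitSplit rB y.2).2 = (qubitSplit rB x.2).2 <;>
      simp [h1, h2]
  · intro k _ hk
    simp [hk.symm]
  · simp
  · intro k _ hk
    simp [hk.symm]
  · simp

theorem card_compl_range_mul {n m : ℕ} (r : Fin m ↪ Fin n)
    [Fintype (((Set.range r)ᶜ : Set (Fin n)) → Fin 2)] :
    2 ^ m * Fintype.card (((Set.range r)ᶜ : Set (Fin n)) → Fin 2) = 2 ^ n := by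
  have h := Fintype.card_congr (qubitSplit r)
  rw [Fintype.card_prod, Fintype.card_fun, Fintype.card_fun, Fintype.card_fin, Fintype.card_fin,
    Fintype.card_fin] at h
  exact h.symm

/-- The projection onto `m` EPR pairs is the range projection of an isometry. -/
theorem exists_isometry_eprProj_eq {nA nB m : ℕ} (rA : Fin m ↪ Fin nA) (rB : Fin m ↪ Fin nB) :
    ∃ (r : ℕ) (J : Matrix (Qubits nA × Qubits nB) (Fin r) ℂ), Jᴴ * J = 1 ∧
      eprProj rA rB = J * Jᴴ ∧ 2 ^ (2 * m) * r = 2 ^ nA * 2 ^ nB := by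
  classical
  let e := (Fintype.equivFin ((((Set.range rA)ᶜ : Set (Fin nA)) → Fin 2) ×
    (((Set.range rB)ᶜ : Set (Fin nB)) → Fin 2))).symm
  refine ⟨_, (eprIsometry rA rB).submatrix id e, ?_, ?_, ?_⟩
  · rw [Matrix.conjTranspose_submatrix]
    have h := Matrix.submatrix_mul_equiv (eprIsometry rA rB)ᴴ (eprIsometry rA rB) e
      (Equiv.refl _) e
    rw [Equiv.coe_refl] at h
    rw [h, eprIsometry_conjTranspose_mul_self, Matrix.submatrix_one_equiv]
  · rw [Matrix.conjTranspose_submatrix, Matrix.submatrix_mul_equiv, Matrix.submatrix_id_id,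
      eprProj_eq_mul_conjTranspose]
  · rw [Fintype.card_prod, ← card_compl_range_mul rA, ← card_compl_range_mul rB, two_mul, pow_add]
    ring

/-! ### Fidelity as a squared norm, and local operators -/

/-- The operator `J ⊗ 1` from `κ × γ` to the tripartite index set. -/
def extendIsometry {α β κ : Type*} (γ : Type*) [DecidableEq γ] (J : Matrix (α × β) κ ℂ) :
    Matrix (α × β × γ) (κ × γ) ℂ :=
  (J ⊗ₖ (1 : Matrix γ γ ℂ)).submatrix (Equiv.prodAssoc α β γ).symm id

theorem extendIsometry_conjTranspose_mul_self {α β γ κ : Type*} [Fintype α] [Fintype β] [Fintype γ]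
    [DecidableEq γ] [DecidableEq κ] {J : Matrix (α × β) κ ℂ} (hJ : Jᴴ * J = 1) :
    (extendIsometry γ J)ᴴ * extendIsometry γ J = 1 := by
  unfold extendIsometry
  rw [Matrix.conjTranspose_submatrix, Matrix.submatrix_mul_equiv, Matrix.conjTranspose_kronecker,
    ← Matrix.mul_kronecker_mul, hJ, Matrix.conjTranspose_one, one_mul, Matrix.one_kronecker_one,
    Matrix.submatrix_id_id]

/-- The local operator `U_A ⊗ U_B ⊗ 1`. -/
def localOperator {α β : Type*} (γ : Type*) [DecidableEq γ] (U : Matrix α α ℂ) (V : Matrix β β ℂ) :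
    Matrix (α × β × γ) (α × β × γ) ℂ :=
  U ⊗ₖ (V ⊗ₖ (1 : Matrix γ γ ℂ))

theorem localOperator_mem_unitaryGroup {α β γ : Type*} [Fintype α] [Fintype β] [Fintype γ]
    [DecidableEq α] [DecidableEq β] [DecidableEq γ] {U : Matrix α α ℂ} {V : Matrix β β ℂ}
    (hU : U ∈ Matrix.unitaryGroup α ℂ) (hV : V ∈ Matrix.unitaryGroup β ℂ) :
    localOperator γ U V ∈ Matrix.unitaryGroup (α × β × γ) ℂ :=
  Matrix.kronecker_mem_unitary hU (Matrix.kronecker_mem_unitary hV (one_mem _))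

/-- Reshaping Ψ into an AB × C matrix `M` gives `ρ_AB = M Mᴴ`. The trace is then the squared
Hilbert–Schmidt norm of `Jᴴ W M`. -/
theorem trace_localUnitary_mul_re {nA nB nC : ℕ} {κ : Type*} [Fintype κ] [DecidableEq κ]
    (UA : Matrix.unitaryGroup (Qubits nA) ℂ) (UB : Matrix.unitaryGroup (Qubits nB) ℂ)
    (J : Matrix (Qubits nA × Qubits nB) κ ℂ) (Ψ : TripartiteSpace nA nB nC) :
    (localUnitary UA UB (reducedAB Ψ) * (J * Jᴴ)).trace.re =
      ‖(Matrix.toEuclideanLin (extendIsometry (Qubits nC) J)).adjoint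
        (Matrix.toEuclideanLin (localOperator (Qubits nC) UA.1 UB.1) Ψ)‖ ^ 2 := by
  set W := (UA : Matrix (Qubits nA) (Qubits nA) ℂ) ⊗ₖ (UB : Matrix (Qubits nB) (Qubits nB) ℂ)
    with hW
  let M : Matrix (Qubits nA × Qubits nB) (Qubits nC) ℂ := Matrix.of fun x z => Ψ (x.1, x.2, z)
  have hM : reducedAB Ψ = M * Mᴴ := by
    ext x y
    simp [reducedAB, M, Matrix.mul_apply]
  let N := Jᴴ * (W * M)
  have htr : localUnitary UA UB (reducedAB Ψ) * (J * Jᴴ) = (W * M) * ((W * M)ᴴ * J * Jᴴ) := by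
    rw [localUnitary, hM, ← hW, Matrix.conjTranspose_mul]
    simp only [Matrix.mul_assoc]
  have htr' : (localUnitary UA UB (reducedAB Ψ) * (J * Jᴴ)).trace = (Nᴴ * N).trace := by
    rw [htr, Matrix.trace_mul_comm]
    simp only [N, Matrix.conjTranspose_mul, Matrix.conjTranspose_conjTranspose, Matrix.mul_assoc]
  have hentry : ∀ k z, ((Matrix.toEuclideanLin (extendIsometry (Qubits nC) J)).adjoint
      (Matrix.toEuclideanLin (localOperator (Qubits nC) UA.1 UB.1) Ψ)) (k, z) = N k z := by
    intro k z
    rw [← Matrix.toEuclideanLin_conjTranspose_eq_adjoint]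
    simp only [Matrix.toLpLin_apply, N, M, Matrix.mulVec, dotProduct, Matrix.mul_apply,
      extendIsometry, localOperator, Matrix.conjTranspose_apply, Matrix.submatrix_apply,
      Matrix.kroneckerMap_apply, Fintype.sum_prod_type, hW, Matrix.of_apply, Matrix.one_apply,
      Equiv.prodAssoc_symm_apply, id]
    simp [apply_ite (starRingEnd ℂ)]
  rw [htr', EuclideanSpace.norm_sq_eq, Matrix.trace, Complex.re_sum, Fintype.sum_prod_type,
    Finset.sum_comm]
  refine Finset.sum_congr rfl fun z _ => ?_
  rw [Matrix.diag_apply, Matrix.mul_apply, Complex.re_sum]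
  refine Finset.sum_congr rfl fun k _ => ?_
  rw [hentry, Matrix.conjTranspose_apply, ← starRingEnd_apply, mul_comm, Complex.mul_conj,
    Complex.ofReal_re, Complex.normSq_eq_norm_sq]

section KroneckerNorm

open scoped Matrix.Norms.L2Operator

variable {m n : Type*} [Fintype m] [Fintype n] [DecidableEq m] [DecidableEq n]

/-- Star homomorphisms of C*-algebras are contractive. -/
theorem norm_kronecker_one_le (A : Matrix m m ℂ) : ‖A ⊗ₖ (1 : Matrix n n ℂ)‖ ≤ ‖A‖ := by
  let f : Matrix m m ℂ →⋆ₐ[ℂ] Matrix (m × n) (m × n) ℂ :=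
    { toFun := fun A => A ⊗ₖ (1 : Matrix n n ℂ)
      map_one' := Matrix.one_kronecker_one
      map_mul' := fun A B => by rw [← Matrix.mul_kronecker_mul, one_mul]
      map_zero' := Matrix.zero_kronecker _
      map_add' := fun A B => Matrix.add_kronecker _ _ _
      commutes' := fun r => by
        rw [Algebra.algebraMap_eq_smul_one, Algebra.algebraMap_eq_smul_one, Matrix.smul_kronecker,
          Matrix.one_kronecker_one]
      map_star' := fun A => by
        simp only [Matrix.star_eq_conjTranspose, Matrix.conjTranspose_kronecker,
          Matrix.conjTranspose_one] }
  exact NonUnitalStarAlgHom.norm_apply_le f A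

theorem norm_one_kronecker_le (A : Matrix m m ℂ) : ‖(1 : Matrix n n ℂ) ⊗ₖ A‖ ≤ ‖A‖ := by
  let f : Matrix m m ℂ →⋆ₐ[ℂ] Matrix (n × m) (n × m) ℂ :=
    { toFun := fun A => (1 : Matrix n n ℂ) ⊗ₖ A
      map_one' := Matrix.one_kronecker_one
      map_mul' := fun A B => by rw [← Matrix.mul_kronecker_mul, one_mul]
      map_zero' := Matrix.kronecker_zero _
      map_add' := fun A B => Matrix.kronecker_add _ _ _
      commutes' := fun r => by
        rw [Algebra.algebraMap_eq_smul_one, Algebra.algebraMap_eq_smul_one, Matrix.kronecker_smul,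
          Matrix.one_kronecker_one]
      map_star' := fun A => by
        simp only [Matrix.star_eq_conjTranspose, Matrix.conjTranspose_kronecker,
          Matrix.conjTranspose_one] }
  exact NonUnitalStarAlgHom.norm_apply_le f A

theorem norm_kronecker_le (A : Matrix m m ℂ) (B : Matrix n n ℂ) : ‖A ⊗ₖ B‖ ≤ ‖A‖ * ‖B‖ := by
  have e : A ⊗ₖ B = (A ⊗ₖ (1 : Matrix n n ℂ)) * ((1 : Matrix m m ℂ) ⊗ₖ B) := by
    rw [← Matrix.mul_kronecker_mul, one_mul, mul_one]
  rw [e]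
  exact (norm_mul_le _ _).trans (mul_le_mul (norm_kronecker_one_le A) (norm_one_kronecker_le B)
    (norm_nonneg _) (norm_nonneg _))

theorem norm_localOperator_sub_le {γ : Type*} [Fintype γ] [DecidableEq γ]
    (U U' : Matrix.unitaryGroup m ℂ) (V V' : Matrix.unitaryGroup n ℂ) :
    ‖localOperator γ U.1 V.1 - localOperator γ U'.1 V'.1‖ ≤ ‖U.1 - U'.1‖ + ‖V.1 - V'.1‖ := by
  have e : localOperator γ U.1 V.1 - localOperator γ U'.1 V'.1 =
      (U.1 - U'.1) ⊗ₖ (V.1 ⊗ₖ (1 : Matrix γ γ ℂ)) +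
        U'.1 ⊗ₖ ((V.1 - V'.1) ⊗ₖ (1 : Matrix γ γ ℂ)) := by
    unfold localOperator
    rw [sub_eq_iff_eq_add, add_assoc, ← Matrix.kronecker_add, ← Matrix.add_kronecker,
      sub_add_cancel, ← Matrix.add_kronecker, sub_add_cancel]
  have hV : ‖V.1 ⊗ₖ (1 : Matrix γ γ ℂ)‖ ≤ 1 :=
    (norm_kronecker_one_le _).trans (norm_le_one_of_mem_unitary V.2)
  have hU : ‖U'.1‖ ≤ 1 := norm_le_one_of_mem_unitary U'.2
  rw [e]
  refine (norm_add_le _ _).trans (add_le_add ?_ ?_)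
  · refine (norm_kronecker_le _ _).trans ?_
    exact mul_le_of_le_one_right (norm_nonneg _) hV
  · refine (norm_kronecker_le _ _).trans ?_
    exact (mul_le_of_le_one_left (norm_nonneg _) hU).trans (norm_kronecker_one_le _)

end KroneckerNorm

/-! ### Lower bounds for the relative entropy -/

/-- The relative entropy of two Bernoulli distributions with parameters `p` and `x`. -/
def bernoulliKL (p x : ℝ) : ℝ :=
  p * (Real.log p - Real.log x) + (1 - p) * (Real.log (1 - p) - Real.log (1 - x))

/-- Pinsker's inequality: the difference of the two sides vanishes at `x = p`, and its derivative in
`x` is `(x - p)(1 - 2x)²/(x(1 - x)) ≥ 0`. -/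
theorem two_mul_sq_le_bernoulliKL {p x : ℝ} (hp : 0 < p) (hpx : p ≤ x) (hx : x < 1) :
    2 * (x - p) ^ 2 ≤ bernoulliKL p x := by
  let g : ℝ → ℝ := fun y => bernoulliKL p y - 2 * (y - p) ^ 2
  have hder : ∀ y, 0 < y → y < 1 → HasDerivAt g
      (p * (0 - y⁻¹) + (1 - p) * (0 - (-1) / (1 - y)) - 2 * (2 * (y - p))) y := by
    intro y hy0 hy1
    have h1 := Real.hasDerivAt_log hy0.ne'
    have h2 := ((hasDerivAt_id y).const_sub 1).log (sub_pos.2 hy1).ne'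
    have h3 : HasDerivAt (fun y : ℝ => (y - p) ^ 2) (2 * (y - p)) y := by
      exact (((hasDerivAt_id y).sub_const p).fun_pow 2).congr_deriv (by simp)
    exact ((((hasDerivAt_const y (Real.log p)).sub h1).const_mul p).add
      (((hasDerivAt_const y (Real.log (1 - p))).sub h2).const_mul (1 - p))).sub (h3.const_mul 2)
  have hmono : MonotoneOn g (Set.Ico p 1) := by
    refine monotoneOn_of_deriv_nonneg (convex_Ico p 1)
      (fun y hy => (hder y (hp.trans_le hy.1) hy.2).continuousAt.continuousWithinAt)
      (fun y hy => ?_) (fun y hy => ?_) <;> rw [interior_Ico] at hy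
    · exact (hder y (hp.trans hy.1) hy.2).differentiableAt.differentiableWithinAt
    · have hy0 : 0 < y := hp.trans hy.1
      have hy1 : 0 < 1 - y := sub_pos.2 hy.2
      rw [(hder y hy0 hy.2).deriv]
      have e : p * (0 - y⁻¹) + (1 - p) * (0 - (-1) / (1 - y)) - 2 * (2 * (y - p)) =
          (y - p) * (1 - 2 * y) ^ 2 / (y * (1 - y)) := by
        field_simp
        ring
      rw [e]
      have := sub_nonneg.2 hy.1.le
      positivity
  have := hmono (Set.left_mem_Ico.2 (hpx.trans_lt hx)) ⟨hpx, hx⟩ hpx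
  simp only [g, bernoulliKL, sub_self] at this ⊢
  linarith

/-- The entropy of `p` is at most `log 2` and `-p log x ≥ 0`. Unlike Pinsker's bound, this one
diverges as `x → 1`. -/
theorem sub_log_two_le_bernoulliKL {p x : ℝ} (hp : 0 < p) (hpx : p ≤ x) (hx : x < 1) :
    -(1 - p) * Real.log (1 - x) - Real.log 2 ≤ bernoulliKL p x := by
  have h1 := Real.binEntropy_le_log_two (p := p)
  rw [Real.binEntropy, Real.log_inv, Real.log_inv] at h1
  have h2 : Real.log x ≤ 0 := Real.log_nonpos (hp.le.trans hpx) hx.le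
  unfold bernoulliKL
  nlinarith [mul_nonpos_of_nonneg_of_nonpos hp.le h2]

/-! ### Counting the qubit choices -/

/-- A crude count suffices: it has the same exponents as the nets. -/
theorem card_embedding_le (k n : ℕ) : Fintype.card (Fin k ↪ Fin n) ≤ 2 ^ (2 ^ n) ^ 2 := by
  rw [Fintype.card_embedding_eq, Fintype.card_fin, Fintype.card_fin]
  rcases lt_or_ge n k with h | h
  · rw [Nat.descFactorial_of_lt h]
    exact Nat.zero_le _
  · have hn : n ≤ 2 ^ n := Nat.lt_two_pow_self.le
    calc n.descFactorial k ≤ n ^ k := Nat.descFactorial_le_pow n k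
      _ ≤ (2 ^ n) ^ k := Nat.pow_le_pow_left hn k
      _ ≤ (2 ^ n) ^ n := Nat.pow_le_pow_right (Nat.two_pow_pos n) h
      _ = 2 ^ (n * n) := (pow_mul _ _ _).symm
      _ ≤ 2 ^ (2 ^ n) ^ 2 := Nat.pow_le_pow_right two_pos (by
        rw [sq]; exact Nat.mul_le_mul hn hn)

/-- The choices of the number of EPR pairs and of the qubits which carry them. -/
abbrev EprChoice (nA nB : ℕ) : Type :=
  Σ k : Fin (nA + 1), (Fin k ↪ Fin nA) × (Fin k ↪ Fin nB)

theorem card_eprChoice_le (nA nB : ℕ) :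
    Fintype.card (EprChoice nA nB) ≤ 4 ^ ((2 ^ nA) ^ 2 + (2 ^ nB) ^ 2) := by
  have h1 : nA + 1 ≤ 2 ^ (2 ^ nA) ^ 2 := by
    have h2 : nA + 1 ≤ 2 ^ nA := Nat.lt_two_pow_self
    refine h2.trans (Nat.pow_le_pow_right two_pos ?_)
    exact Nat.lt_two_pow_self.le.trans (Nat.le_self_pow two_ne_zero _)
  rw [Fintype.card_sigma]
  calc ∑ k : Fin (nA + 1), Fintype.card ((Fin k ↪ Fin nA) × (Fin k ↪ Fin nB))
      ≤ ∑ _k : Fin (nA + 1), 2 ^ (2 ^ nA) ^ 2 * 2 ^ (2 ^ nB) ^ 2 := by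
        refine Finset.sum_le_sum fun k _ => ?_
        rw [Fintype.card_prod]
        exact Nat.mul_le_mul (card_embedding_le _ _) (card_embedding_le _ _)
    _ = (nA + 1) * (2 ^ (2 ^ nA) ^ 2 * 2 ^ (2 ^ nB) ^ 2) := by simp
    _ ≤ 2 ^ (2 ^ nA) ^ 2 * (2 ^ (2 ^ nA) ^ 2 * 2 ^ (2 ^ nB) ^ 2) := Nat.mul_le_mul_right _ h1
    _ ≤ 2 ^ (2 ^ nA) ^ 2 * (2 ^ (2 ^ nA) ^ 2 * 2 ^ (2 ^ nB) ^ 2) * 2 ^ (2 ^ nB) ^ 2 :=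
        Nat.le_mul_of_pos_right _ (Nat.two_pow_pos _)
    _ = 4 ^ ((2 ^ nA) ^ 2 + (2 ^ nB) ^ 2) := by
        rw [pow_add, show 4 = 2 * 2 from rfl, mul_pow, mul_pow]
        ring

/-! ### Tail bound and stability for fixed local unitaries -/

section Fidelity

variable {nA nB nC : ℕ}

/-- `a = p/x` and `b = (1 - p)/(1 - x)` optimise the Chernoff bound under `xa + (1 - x)b = 1`; the
optimum is the relative entropy. `p ≤ x` ensures `a ≤ b`. -/
theorem haarState_le_trace_localUnitary_le {m : ℕ} (rA : Fin m ↪ Fin nA)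
    (rB : Fin m ↪ Fin nB) (UA : Matrix.unitaryGroup (Qubits nA) ℂ)
    (UB : Matrix.unitaryGroup (Qubits nB) ℂ) {x : ℝ} (hx : ((2 : ℝ) ^ (2 * m))⁻¹ ≤ x)
    (hx1 : x < 1) :
    haarState nA nB nC
      {Ψ | x ≤ (localUnitary UA UB (reducedAB Ψ.1) * eprProj rA rB).trace.re} ≤
      ENNReal.ofReal (Real.exp
        (-(bernoulliKL ((2 : ℝ) ^ (2 * m))⁻¹ x * (2 : ℝ) ^ (nA + nB + nC)))) := by
  set p : ℝ := ((2 : ℝ) ^ (2 * m))⁻¹ with hp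
  have hp0 : 0 < p := by positivity
  have hx0 : 0 < x := hp0.trans_le hx
  have hy0 : 0 < 1 - x := sub_pos.2 hx1
  have hq0 : 0 < 1 - p := by linarith
  have hab : p / x ≤ (1 - p) / (1 - x) := by
    rw [div_le_div_iff₀ hx0 hy0]
    nlinarith
  have hxab : x * (p / x) + (1 - x) * ((1 - p) / (1 - x)) = 1 := by
    field_simp
    ring
  obtain ⟨r, J, hJ, hproj, hr⟩ := exists_isometry_eprProj_eq rA rB
  have hisom : ((localOperator (Qubits nC) UA.1 UB.1)ᴴ * extendIsometry (Qubits nC) J)ᴴ *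
      ((localOperator (Qubits nC) UA.1 UB.1)ᴴ * extendIsometry (Qubits nC) J) = 1 := by
    have hW := Matrix.mem_unitaryGroup_iff.1
      (localOperator_mem_unitaryGroup (γ := Qubits nC) UA.2 UB.2)
    rw [Matrix.star_eq_conjTranspose] at hW
    rw [Matrix.conjTranspose_mul, Matrix.conjTranspose_conjTranspose, Matrix.mul_assoc,
      ← Matrix.mul_assoc (localOperator _ _ _), hW, Matrix.one_mul]
    exact extendIsometry_conjTranspose_mul_self hJ
  have htrace : ∀ Ψ : TripartiteSpace nA nB nC,
      (localUnitary UA UB (reducedAB Ψ) * eprProj rA rB).trace.re =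
        ‖(Matrix.toEuclideanLin ((localOperator (Qubits nC) UA.1 UB.1)ᴴ *
          extendIsometry (Qubits nC) J)).adjoint Ψ‖ ^ 2 := by
    intro Ψ
    rw [hproj, trace_localUnitary_mul_re, ← Matrix.toEuclideanLin_conjTranspose_eq_adjoint,
      ← Matrix.toEuclideanLin_conjTranspose_eq_adjoint, Matrix.conjTranspose_mul,
      Matrix.conjTranspose_conjTranspose]
    simp only [Matrix.toLpLin_apply, Matrix.mulVec_mulVec]
  simp only [htrace]
  have key := toSphere_le_norm_adjoint_sq_le hisom (div_pos hp0 hx0) hab hxab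
  have hd : (Fintype.card (Qubits nA × Qubits nB × Qubits nC) : ℝ) =
      (2 : ℝ) ^ (nA + nB + nC) := by
    simp [Fintype.card_prod, pow_add, mul_assoc]
  have hr' : (Fintype.card (Fin r × Qubits nC) : ℝ) = p * (2 : ℝ) ^ (nA + nB + nC) := by
    have h1 : (2 : ℝ) ^ (2 * m) * r = 2 ^ nA * 2 ^ nB := by exact_mod_cast hr
    have hC : (Fintype.card (Qubits nC) : ℝ) = 2 ^ nC := by simp
    rw [Fintype.card_prod, Nat.cast_mul, hC, Fintype.card_fin, pow_add, pow_add, ← h1, hp]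
    field_simp
  have hexp : (((1 - p) / (1 - x)) ^ Fintype.card (Qubits nA × Qubits nB × Qubits nC) *
      (p / x / ((1 - p) / (1 - x))) ^ Fintype.card (Fin r × Qubits nC))⁻¹ =
      Real.exp (-(bernoulliKL p x * (2 : ℝ) ^ (nA + nB + nC))) := by
    have ha : 0 < p / x := div_pos hp0 hx0
    have hb : 0 < (1 - p) / (1 - x) := div_pos hq0 hy0
    rw [Real.exp_neg]
    congr 1
    rw [← Real.exp_log (mul_pos (pow_pos hb _) (pow_pos (div_pos ha hb) _)),
      Real.log_mul (pow_pos hb _).ne' (pow_pos (div_pos ha hb) _).ne', Real.log_pow, Real.log_pow,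
      Real.log_div ha.ne' hb.ne', Real.log_div hp0.ne' hx0.ne', Real.log_div hq0.ne' hy0.ne',
      hd, hr', bernoulliKL]
    congr 1
    ring
  rw [hexp] at key
  rw [haarState, Measure.smul_apply, smul_eq_mul]
  refine (mul_le_mul_right key _).trans ?_
  rw [mul_left_comm]
  exact mul_le_of_le_one_right zero_le (ENNReal.inv_mul_le_one _)

open scoped Matrix.Norms.L2Operator in
/-- Stability of the fidelity under a perturbation of the local unitaries. -/
theorem le_trace_localUnitary_of_norm_sub_le {m : ℕ} (rA : Fin m ↪ Fin nA)
    (rB : Fin m ↪ Fin nB) {UA VA : Matrix.unitaryGroup (Qubits nA) ℂ}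
    {UB VB : Matrix.unitaryGroup (Qubits nB) ℂ} {ε h x : ℝ} (h0 : 0 ≤ h) (h1 : h ≤ 1)
    (hA : ‖(UA : Matrix (Qubits nA) (Qubits nA) ℂ) - VA‖ ≤ ε)
    (hB : ‖(UB : Matrix (Qubits nB) (Qubits nB) ℂ) - VB‖ ≤ ε) (Ψ : PureState nA nB nC)
    (hx : x ≤ h ^ 2 - 4 * ε ∨ x ≤ 1 - (√(1 - h ^ 2) + 2 * ε) ^ 2)
    (hF : h ^ 2 ≤ (localUnitary UA UB (reducedAB Ψ.1) * eprProj rA rB).trace.re) :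
    x ≤ (localUnitary VA VB (reducedAB Ψ.1) * eprProj rA rB).trace.re := by
  obtain ⟨r, J, hJ, hproj, -⟩ := exists_isometry_eprProj_eq rA rB
  rw [hproj, trace_localUnitary_mul_re] at hF ⊢
  have hL := adjoint_comp_toEuclideanLin_eq_id (extendIsometry_conjTranspose_mul_self
    (γ := Qubits nC) hJ)
  have hΨ1 : ‖Ψ.1‖ = 1 := mem_sphere_zero_iff_norm.1 Ψ.2
  have hunit : ∀ (U : Matrix.unitaryGroup (Qubits nA) ℂ)
      (V : Matrix.unitaryGroup (Qubits nB) ℂ),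
      ‖Matrix.toEuclideanLin (localOperator (Qubits nC) U.1 V.1) Ψ.1‖ = 1 := by
    intro U V
    rw [norm_apply_of_adjoint_comp_eq_id, hΨ1]
    exact adjoint_comp_toEuclideanLin_eq_id (Matrix.mem_unitaryGroup_iff'.1
      (localOperator_mem_unitaryGroup U.2 V.2))
  have hdist : ‖Matrix.toEuclideanLin (localOperator (Qubits nC) UA.1 UB.1) Ψ.1 -
      Matrix.toEuclideanLin (localOperator (Qubits nC) VA.1 VB.1) Ψ.1‖ ≤ 2 * ε := by
    rw [← LinearMap.sub_apply, ← map_sub, Matrix.toLpLin_apply]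
    refine (Matrix.l2_opNorm_mulVec _ _).trans ?_
    rw [hΨ1, mul_one]
    refine (norm_localOperator_sub_le UA VA UB VB).trans ?_
    linarith
  rcases hx with hx | hx
  · refine hx.trans (le_trans (le_of_eq ?_) (sub_le_norm_adjoint_sq hL h0 h1 hdist hF))
    ring
  · have hh : 0 ≤ 1 - h ^ 2 := by nlinarith
    refine hx.trans (one_sub_sq_le_norm_adjoint_sq hL (Real.sqrt_nonneg _) (hunit _ _)
      (hunit _ _) hdist ?_)
    rwa [Real.sq_sqrt hh, sub_sub_cancel]

end Fidelity

/-! ### Union bound -/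

/-- The union bound over nets of the two unitary groups. -/
theorem haarState_le_luDistillable_le {nA nB nC m : ℕ} {h x ε B : ℝ} (hm : 0 < m) (h0 : 0 ≤ h)
    (h1 : h ≤ 1) (hε : 0 < ε) (hε1 : ε ≤ 1) (hpx : ((2 : ℝ) ^ (2 * m))⁻¹ ≤ x) (hx1 : x < 1)
    (hx : x ≤ h ^ 2 - 4 * ε ∨ x ≤ 1 - (√(1 - h ^ 2) + 2 * ε) ^ 2)
    (hB : ∀ p, 0 < p → p ≤ ((2 : ℝ) ^ (2 * m))⁻¹ → B ≤ bernoulliKL p x) :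
    haarState nA nB nC {Ψ | m ≤ luDistillable h (reducedAB Ψ.1)} ≤
      ENNReal.ofReal (Real.exp ((((2 : ℝ) ^ nA) ^ 2 + ((2 : ℝ) ^ nB) ^ 2) *
        (Real.log 4 + Real.log (75 / ε)) - B * (2 : ℝ) ^ (nA + nB + nC))) := by
  classical
  obtain ⟨SA, hSA, hnetA⟩ := exists_unitary_net (Qubits nA) hε hε1
  obtain ⟨SB, hSB, hnetB⟩ := exists_unitary_net (Qubits nB) hε hε1
  let Ev : EprChoice nA nB × Matrix.unitaryGroup (Qubits nA) ℂ ×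
      Matrix.unitaryGroup (Qubits nB) ℂ → Set (PureState nA nB nC) := fun q =>
    {Ψ | m ≤ q.1.1 ∧
      x ≤ (localUnitary q.2.1 q.2.2 (reducedAB Ψ.1) * eprProj q.1.2.1 q.1.2.2).trace.re}
  let I : Finset (EprChoice nA nB × Matrix.unitaryGroup (Qubits nA) ℂ ×
      Matrix.unitaryGroup (Qubits nB) ℂ) := Finset.univ ×ˢ (SA ×ˢ SB)
  have hcover : {Ψ : PureState nA nB nC | m ≤ luDistillable h (reducedAB Ψ.1)} ⊆
      ⋃ q ∈ I, Ev q := by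
    intro Ψ hΨ
    have hΨ' : m ≤ sSup (luDistillableSet h (reducedAB Ψ.1)) := hΨ
    have hne : (luDistillableSet h (reducedAB Ψ.1)).Nonempty := by
      -- The supremum of the empty set is 0, which `m > 0` excludes.
      by_contra hempty
      rw [Set.not_nonempty_iff_eq_empty.1 hempty, csSup_empty] at hΨ'
      exact absurd hΨ' hm.not_ge
    -- The event is witnessed at the supremum `k ≥ m`, not at `m` itself; hence `hB` covers all `p ≤
    -- 4^(-m)`.
    have hmem := Nat.sSup_mem hne (bddAbove_luDistillableSet h (reducedAB Ψ.1))
    set k := sSup (luDistillableSet h (reducedAB Ψ.1))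
    obtain ⟨rA, rB, UA, UB, hF⟩ := hmem
    have hk : k < nA + 1 := by
      have : k ≤ nA := by simpa using Fintype.card_le_of_embedding rA
      omega
    obtain ⟨VA, hVA, hdA⟩ := hnetA UA
    obtain ⟨VB, hVB, hdB⟩ := hnetB UB
    refine Set.mem_iUnion₂.2 ⟨(⟨⟨k, hk⟩, rA, rB⟩, VA, VB), ?_, hΨ', ?_⟩
    · exact Finset.mem_product.2 ⟨Finset.mem_univ _, Finset.mem_product.2 ⟨hVA, hVB⟩⟩
    · exact le_trace_localUnitary_of_norm_sub_le rA rB h0 h1 hdA.le hdB.le Ψ hx hF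
  have hsingle : ∀ q ∈ I, haarState nA nB nC (Ev q) ≤
      ENNReal.ofReal (Real.exp (-(B * (2 : ℝ) ^ (nA + nB + nC)))) := by
    rintro ⟨⟨k, rA, rB⟩, VA, VB⟩ -
    by_cases hmk : m ≤ k
    · have hpk : ((2 : ℝ) ^ (2 * (k : ℕ)))⁻¹ ≤ ((2 : ℝ) ^ (2 * m))⁻¹ := by
        gcongr
        exact one_le_two
      refine (measure_mono fun Ψ hΨ => hΨ.2).trans
        ((haarState_le_trace_localUnitary_le rA rB VA VB (hpk.trans hpx) hx1).trans ?_)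
      gcongr
      exact hB _ (by positivity) hpk
    · have : Ev (⟨k, rA, rB⟩, VA, VB) = ∅ := Set.eq_empty_of_forall_notMem fun Ψ hΨ => hmk hΨ.1
      rw [this, measure_empty]
      exact zero_le
  have hcardI : (I.card : ℝ) ≤ Real.exp ((((2 : ℝ) ^ nA) ^ 2 + ((2 : ℝ) ^ nB) ^ 2) *
      (Real.log 4 + Real.log (75 / ε))) := by
    have hA : Fintype.card (Qubits nA) = 2 ^ nA := by simp
    have hB : Fintype.card (Qubits nB) = 2 ^ nB := by simp
    rw [hA] at hSA
    rw [hB] at hSB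
    have hC : (Fintype.card (EprChoice nA nB) : ℝ) ≤ 4 ^ ((2 ^ nA) ^ 2 + (2 ^ nB) ^ 2) := by
      exact_mod_cast card_eprChoice_le nA nB
    have he : (0 : ℝ) < 75 / ε := by positivity
    calc (I.card : ℝ) = Fintype.card (EprChoice nA nB) * (SA.card * SB.card) := by
          simp only [I, Finset.card_product, Finset.card_univ, Nat.cast_mul]
      _ ≤ 4 ^ ((2 ^ nA) ^ 2 + (2 ^ nB) ^ 2) *
          ((75 / ε) ^ (2 ^ nA) ^ 2 * (75 / ε) ^ (2 ^ nB) ^ 2) := by gcongr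
      _ = (4 * (75 / ε)) ^ ((2 ^ nA) ^ 2 + (2 ^ nB) ^ 2) := by rw [mul_pow, ← pow_add]
      _ = _ := by
          rw [← Real.log_mul four_ne_zero he.ne', ← Real.exp_log (pow_pos (mul_pos four_pos he) _),
            Real.log_pow]
          push_cast
          rfl
  calc haarState nA nB nC {Ψ | m ≤ luDistillable h (reducedAB Ψ.1)}
      ≤ haarState nA nB nC (⋃ q ∈ I, Ev q) := measure_mono hcover
    _ ≤ ∑ q ∈ I, haarState nA nB nC (Ev q) := measure_biUnion_finset_le _ _
    _ ≤ I.card • ENNReal.ofReal (Real.exp (-(B * (2 : ℝ) ^ (nA + nB + nC)))) :=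
        Finset.sum_le_card_nsmul _ _ _ hsingle
    _ = ENNReal.ofReal (I.card * Real.exp (-(B * (2 : ℝ) ^ (nA + nB + nC)))) := by
        rw [nsmul_eq_mul, ENNReal.ofReal_mul (Nat.cast_nonneg _), ENNReal.ofReal_natCast]
    _ ≤ _ := by
        rw [sub_eq_add_neg, Real.exp_add]
        gcongr

/-! ### Choice of parameters -/

theorem ennreal_log_le_of_le_ofReal_exp {a : ℝ≥0∞} {r s : ℝ}
    (h : a ≤ ENNReal.ofReal (Real.exp r)) (hrs : r ≤ s) : ENNReal.log a ≤ (s : EReal) := by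
  refine (ENNReal.log_monotone h).trans ?_
  rw [ENNReal.log_ofReal_of_pos (Real.exp_pos r), Real.log_exp]
  exact EReal.coe_le_coe_iff.2 hrs

theorem pos_of_sub_inv_two_pow_pos {m : ℕ} {h : ℝ} (h0 : 0 < h) (h1 : h ≤ 1)
    (hδ : 0 < h ^ 2 - ((2 : ℝ) ^ (2 * m))⁻¹) : 0 < m := by
  rcases Nat.eq_zero_or_pos m with rfl | hm
  · have := pow_le_one₀ (n := 2) h0.le h1
    rw [mul_zero, pow_zero, inv_one] at hδ
    linarith
  · exact hm

theorem exists_log_haarState_le_of_le (c : ℝ) (hc0 : 0 < c) (hc2 : c < 2) (δ₀ : ℝ)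
    (hδ₀ : δ₀ < 1) :
    ∃ K : ℝ, 0 < K ∧ ∀ (nA nB nC m : ℕ) (h δ : ℝ), 0 < h → h ≤ 1 →
      δ = h ^ 2 - ((2 : ℝ) ^ (2 * m))⁻¹ → 0 < δ → δ ≤ δ₀ →
      ENNReal.log (haarState nA nB nC {Ψ | m ≤ luDistillable h (reducedAB Ψ.1)}) ≤
        ((-c * δ ^ 2 * (2 : ℝ) ^ (nA + nB + nC) +
          K * (((2 : ℝ) ^ nA) ^ 2 + ((2 : ℝ) ^ nB) ^ 2) * Real.log (1 / δ) : ℝ) : EReal) := by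
  rcases le_or_gt δ₀ 0 with hneg | hpos
  · exact ⟨1, one_pos, fun _ _ _ _ _ _ _ _ _ h1 h2 =>
      absurd (h1.trans_le (h2.trans hneg)) (lt_irrefl _)⟩
  -- With `ε = κδ`, the gap `x - p` is at least `(1 - 4κ)δ`, and `2(1 - 4κ)² ≥ 2 - 16κ = c`.
  set κ : ℝ := (2 - c) / 16 with hκ
  have hκ0 : 0 < κ := by rw [hκ]; linarith
  have hκ1 : κ < 1 / 8 := by rw [hκ]; linarith
  have hl0 : 0 < Real.log (1 / δ₀) := Real.log_pos ((one_lt_div hpos).2 hδ₀)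
  set M : ℝ := Real.log 4 + Real.log (75 / κ) with hM
  have hM0 : 0 < M := by
    refine add_pos (Real.log_pos (by norm_num)) (Real.log_pos ?_)
    rw [one_lt_div hκ0]
    linarith
  -- The net costs `M + log(1/δ)` per dimension, and `log(1/δ) ≥ log(1/δ₀) > 0` absorbs `M`.
  refine ⟨1 + M / Real.log (1 / δ₀), by positivity, ?_⟩
  intro nA nB nC m h δ h0 h1 hδ hδ0 hδle
  have hm := pos_of_sub_inv_two_pow_pos h0 h1 (hδ ▸ hδ0)
  have hp0 : 0 < ((2 : ℝ) ^ (2 * m))⁻¹ := by positivity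
  have hδ1 : δ < 1 := hδle.trans_lt hδ₀
  have hh1 : h ^ 2 ≤ 1 := pow_le_one₀ h0.le h1
  have hκδ : 0 < κ * δ := mul_pos hκ0 hδ0
  have hB : ∀ p, 0 < p → p ≤ ((2 : ℝ) ^ (2 * m))⁻¹ →
      c * δ ^ 2 ≤ bernoulliKL p (h ^ 2 - 4 * (κ * δ)) := by
    intro p hp hple
    have hd : (1 - 4 * κ) * δ ≤ h ^ 2 - 4 * (κ * δ) - p := by linarith
    have hd0 : 0 ≤ (1 - 4 * κ) * δ := mul_nonneg (by linarith) hδ0.le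
    refine le_trans ?_ (two_mul_sq_le_bernoulliKL hp (by linarith) (by linarith))
    have h2 := pow_le_pow_left₀ hd0 hd 2
    have h3 : c ≤ 2 * (1 - 4 * κ) ^ 2 := by
      have : c = 2 - 16 * κ := by rw [hκ]; ring
      nlinarith [sq_nonneg κ]
    nlinarith [mul_le_mul_of_nonneg_right h3 (sq_nonneg δ)]
  have key := haarState_le_luDistillable_le (nA := nA) (nB := nB) (nC := nC) (m := m) (h := h)
    (x := h ^ 2 - 4 * (κ * δ)) (ε := κ * δ) (B := c * δ ^ 2) hm h0.le h1 hκδ (by nlinarith)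
    (by nlinarith) (by linarith) (Or.inl le_rfl) hB
  refine ennreal_log_le_of_le_ofReal_exp key ?_
  have hlog : Real.log (75 / (κ * δ)) = Real.log (75 / κ) + Real.log (1 / δ) := by
    rw [← Real.log_mul (by positivity) (by positivity)]
    congr 1
    field_simp
  have hlδ : Real.log (1 / δ₀) ≤ Real.log (1 / δ) :=
    Real.log_le_log (by positivity) (one_div_le_one_div_of_le hδ0 hδle)
  have hMle : M ≤ M / Real.log (1 / δ₀) * Real.log (1 / δ) := by
    rw [div_mul_eq_mul_div, le_div_iff₀ hl0]
    exact mul_le_mul_of_nonneg_left hlδ hM0.le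
  have hD : 0 ≤ ((2 : ℝ) ^ nA) ^ 2 + ((2 : ℝ) ^ nB) ^ 2 := by positivity
  rw [hlog, ← add_assoc, ← hM]
  nlinarith [mul_le_mul_of_nonneg_left hMle hD]

/-- When the subsystems `A` and `B` have fewer than half of the qubits, distilling EPR pairs almost
perfectly is exponentially unlikely in the total dimension. -/
theorem haarState_le_luDistillable_le_exp_neg {nA nB nC m : ℕ} {h : ℝ} (h0 : 0 < h) (h1 : h ≤ 1)
    (hδ : 1 - Real.exp (-44) < h ^ 2 - ((2 : ℝ) ^ (2 * m))⁻¹)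
    (hA : 2 * nA < nA + nB + nC) (hB : 2 * nB < nA + nB + nC) :
    haarState nA nB nC {Ψ | m ≤ luDistillable h (reducedAB Ψ.1)} ≤
      ENNReal.ofReal (Real.exp (-(2 * (2 : ℝ) ^ (nA + nB + nC)))) := by
  set η : ℝ := Real.exp (-44) with hη
  have hη0 : 0 < η := Real.exp_pos _
  have hη1 : η ≤ 1 / 45 := by
    rw [hη, Real.exp_neg, one_div]
    refine inv_anti₀ (by norm_num) ?_
    have := Real.add_one_le_exp (44 : ℝ)
    linarith
  have hp0 : 0 < ((2 : ℝ) ^ (2 * m))⁻¹ := by positivity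
  have hh1 : h ^ 2 ≤ 1 := pow_le_one₀ h0.le h1
  have hm := pos_of_sub_inv_two_pow_pos h0 h1 (lt_of_le_of_lt (by linarith) hδ)
  -- `2ε = √η` matches the bound on `√(1 - h²)`, so the fidelity stays at least `1 - (2√η)² = 1 -
  -- 4η`.
  set ε : ℝ := Real.exp (-22) / 2 with hε
  have hε0 : 0 < ε := by positivity
  have hε1 : ε ≤ 1 := by
    have : Real.exp (-22) ≤ 1 := Real.exp_le_one_iff.2 (by norm_num)
    linarith
  have hsq : (2 * ε) ^ 2 = η := by
    rw [hε, hη, mul_div_cancel₀ _ two_ne_zero, ← Real.exp_nat_mul]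
    norm_num
  have hsqrt : √(1 - h ^ 2) ≤ 2 * ε := by
    refine Real.sqrt_le_iff.2 ⟨by positivity, ?_⟩
    rw [hsq]
    linarith
  have hlog2 : Real.log 2 < 0.7 := Real.log_two_lt_d9.trans (by norm_num)
  have hlog2' : 0.6 < Real.log 2 := lt_trans (by norm_num) Real.log_two_gt_d9
  have hlog4 : Real.log 4 = 2 * Real.log 2 := by
    rw [show (4 : ℝ) = 2 ^ 2 by norm_num, Real.log_pow]; norm_num
  have hlogy : Real.log (1 - (1 - 4 * η)) = 2 * Real.log 2 - 44 := by
    rw [sub_sub_cancel, Real.log_mul four_ne_zero hη0.ne', hlog4, hη, Real.log_exp]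
    ring
  have hlogε : Real.log (75 / ε) ≤ 8 * Real.log 2 + 22 := by
    have e : 75 / ε = 150 * Real.exp 22 := by
      rw [hε, Real.exp_neg]
      field_simp
      norm_num
    rw [e, Real.log_mul (by norm_num) (Real.exp_pos _).ne', Real.log_exp]
    have : Real.log 150 ≤ Real.log (2 ^ 8) := Real.log_le_log (by norm_num) (by norm_num)
    rw [Real.log_pow] at this
    push_cast at this
    linarith
  have hKL : ∀ p, 0 < p → p ≤ ((2 : ℝ) ^ (2 * m))⁻¹ →
      3 / 4 * (44 - 2 * Real.log 2) - Real.log 2 ≤ bernoulliKL p (1 - 4 * η) := by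
    intro p hp hple
    refine le_trans ?_ (sub_log_two_le_bernoulliKL hp (by linarith) (by linarith))
    rw [hlogy]
    have : 3 / 4 ≤ 1 - p := by linarith
    nlinarith
  have key := haarState_le_luDistillable_le (nA := nA) (nB := nB) (nC := nC) (m := m) (h := h)
    (x := 1 - 4 * η) (ε := ε) hm h0.le h1 hε0 hε1 (by linarith) (by linarith)
    (Or.inr (by
      have : (√(1 - h ^ 2) + 2 * ε) ^ 2 ≤ (2 * ε + 2 * ε) ^ 2 := by gcongr
      nlinarith)) hKL
  refine key.trans (ENNReal.ofReal_le_ofReal (Real.exp_le_exp.2 ?_))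
  -- The strict inequality of integers gains the factor 2 that yields `d_A² + d_B² ≤ d`.
  have hdim : ∀ k : ℕ, 2 * k < nA + nB + nC → 2 * ((2 : ℝ) ^ k) ^ 2 ≤ 2 ^ (nA + nB + nC) := by
    intro k hk
    rw [← pow_mul, ← pow_succ']
    exact pow_le_pow_right₀ one_le_two (by omega)
  have hD := hdim nA hA
  have hD' := hdim nB hB
  have hsum : ((2 : ℝ) ^ nA) ^ 2 + ((2 : ℝ) ^ nB) ^ 2 ≤ 2 ^ (nA + nB + nC) := by linarith
  have hcoef : 0 ≤ Real.log 4 + (8 * Real.log 2 + 22) := by linarith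
  have hd0 : (0 : ℝ) < 2 ^ (nA + nB + nC) := by positivity
  calc (((2 : ℝ) ^ nA) ^ 2 + ((2 : ℝ) ^ nB) ^ 2) * (Real.log 4 + Real.log (75 / ε)) -
        (3 / 4 * (44 - 2 * Real.log 2) - Real.log 2) * 2 ^ (nA + nB + nC)
      ≤ 2 ^ (nA + nB + nC) * (Real.log 4 + (8 * Real.log 2 + 22)) -
        (3 / 4 * (44 - 2 * Real.log 2) - Real.log 2) * 2 ^ (nA + nB + nC) := by
        refine sub_le_sub_right (mul_le_mul hsum ?_ ?_ hd0.le) _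
        · linarith
        · exact add_nonneg (by linarith) (Real.log_nonneg ((one_le_div hε0).2 (by linarith)))
    -- The net contributes 22 and the relative entropy `3/4 · 44 = 33`. The margin 11 covers `12.5
    -- log 2` and leaves 2.
    _ = (2 * Real.log 2 + 8 * Real.log 2 + 22 - 3 / 4 * (44 - 2 * Real.log 2) + Real.log 2) *
        2 ^ (nA + nB + nC) := by rw [hlog4]; ring
    _ ≤ -2 * 2 ^ (nA + nB + nC) := by
        refine mul_le_mul_of_nonneg_right ?_ hd0.le
        linarith
    _ = _ := by ring

end

theorem theorem1 (c : ℝ) (hc0 : 0 < c) (hc2 : c < 2) :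
    -- `A` and `B` have fewer than half of the qubits: the constant depends only on `c`
    (∃ K : ℝ, 0 < K ∧ ∀ (nA nB nC m : ℕ) (h δ : ℝ), 0 < h → h ≤ 1 →
      δ = h ^ 2 - ((2 : ℝ) ^ (2 * m))⁻¹ → 0 < δ →
      2 * nA < nA + nB + nC → 2 * nB < nA + nB + nC →
      ENNReal.log (haarState nA nB nC {Ψ | m ≤ luDistillable h (reducedAB Ψ.1)}) ≤
        ((-c * δ ^ 2 * (2 : ℝ) ^ (nA + nB + nC) +
          K * (((2 : ℝ) ^ nA) ^ 2 + ((2 : ℝ) ^ nB) ^ 2) * Real.log (1 / δ) : ℝ) : EReal)) ∧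
    -- subsystems of arbitrary sizes: the constant depends also on an upper bound of `δ`
    (∀ δ₀ : ℝ, δ₀ < 1 → ∃ K : ℝ, 0 < K ∧ ∀ (nA nB nC m : ℕ) (h δ : ℝ), 0 < h → h ≤ 1 →
      δ = h ^ 2 - ((2 : ℝ) ^ (2 * m))⁻¹ → 0 < δ → δ ≤ δ₀ →
      ENNReal.log (haarState nA nB nC {Ψ | m ≤ luDistillable h (reducedAB Ψ.1)}) ≤
        ((-c * δ ^ 2 * (2 : ℝ) ^ (nA + nB + nC) +
          K * (((2 : ℝ) ^ nA) ^ 2 + ((2 : ℝ) ^ nB) ^ 2) * Real.log (1 / δ) : ℝ) : EReal)) := by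
  refine ⟨?_, exists_log_haarState_le_of_le c hc0 hc2⟩
  obtain ⟨K, hK, hbound⟩ := exists_log_haarState_le_of_le c hc0 hc2 (1 - Real.exp (-44))
    (sub_lt_self _ (Real.exp_pos _))
  refine ⟨K, hK, fun nA nB nC m h δ h0 h1 hδ hδ0 hA hB => ?_⟩
  rcases le_or_gt δ (1 - Real.exp (-44)) with hle | hgt
  · exact hbound nA nB nC m h δ h0 h1 hδ hδ0 hle
  -- Here `exp(-2d)` suffices because `cδ² ≤ 2`; the logarithmic term is only needed to be
  -- nonnegative.
  · refine ennreal_log_le_of_le_ofReal_exp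
      (haarState_le_luDistillable_le_exp_neg h0 h1 (hδ ▸ hgt) hA hB) ?_
    have hp0 : 0 < ((2 : ℝ) ^ (2 * m))⁻¹ := by positivity
    have hδ1 : δ ≤ 1 := by
      have := pow_le_one₀ (n := 2) h0.le h1
      linarith
    have hlog : 0 ≤ Real.log (1 / δ) := Real.log_nonneg ((one_le_div hδ0).2 hδ1)
    have hcδ : c * δ ^ 2 ≤ 2 := by nlinarith [pow_le_one₀ (n := 2) hδ0.le hδ1]
    have hd0 : (0 : ℝ) < 2 ^ (nA + nB + nC) := by positivity
    have hrest : 0 ≤ K * (((2 : ℝ) ^ nA) ^ 2 + ((2 : ℝ) ^ nB) ^ 2) * Real.log (1 / δ) := by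
      positivity
    nlinarith [mul_le_mul_of_nonneg_right hcδ hd0.le]
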